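/- Let $G$ be a finite group of order $n$ and let $f:G\to\mathbb{Q}$ be a class function (that is, $f(ghg^{-1})=f(h)$ for all $g,h\in G$) with $f(g)=f(g^{-1})$ for all $g\in G$. Let $\Gamma_f=\operatorname{Cay}(G,f)$ be the Cayley colour graph of $f$: the undirected graph (loops allowed) with vertex set $G$ in which $g$ and $h$ are joined by an edge of colour $f(gh^{-1})$ whenever $f(gh^{-1})\neq 0$. Its adjacency matrix is $[f(gh^{-1})]_{g,h\in G}$; its splitting field $\mathbb{SF}(\Gamma_f)\subseteq\mathbb{C}$ is the smallest extension of $\mathbb{Q}$ containing all eigenvalues of this matrix, and its algebraic degree is $\operatorname{Deg}(\Gamma_f)=[\mathbb{SF}(\Gamma_f):\mathbb{Q}]$. Put $\zeta_n=e^{2\pi i/n}$, let $\eta:\operatorname{Gal}(\mathbb{Q}(\zeta_n)/\mathbb{Q})\to(\mathbb{Z}/n\mathbb{Z})^*$ be the isomorphism determined by $\sigma(\zeta_n)=\zeta_n^{\eta(\sigma)}$, and let $H_f=\{h\in(\mathbb{Z}/n\mathbb{Z})^* \mid f(g^h)=f(g)\text{ for all }g\in G\}$, which is a subgroup of $(\mathbb{Z}/n\mathbb{Z})^*$.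 Then $$\mathbb{SF}(\Gamma_f)=\mathbb{Q}(\zeta_n)^{\eta^{-1}(H_f)}=\{x\in\mathbb{Q}(\zeta_n)\mid \sigma(x)=x\text{ for all }\sigma\in\eta^{-1}(H_f)\}.$$ Moreover, $$\operatorname{Deg}(\Gamma_f)=\frac{\varphi(n)}{|H_f|},$$ where $\varphi$ is Euler's totient function. -/

import Mathlib

open scoped IntermediateField

namespace CayleyColour

/-- An undirected graph on `V` (loops allowed) whose edges carry non-zero rational colours.
The vertices `u`, `v` are joined by an edge exactly when `colour u v ≠ 0`, and `colour u v` is then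
the colour of that edge. -/
structure ColourGraph (V : Type*) where
  colour : V → V → ℚ
  symm : ∀ u v, colour u v = colour v u

namespace ColourGraph

variable {V : Type*}

/-- The adjacency matrix: its `(u, v)` entry is the colour of the edge `uv`, or `0` if there is no
edge. -/
def adjMatrix (Γ : ColourGraph V) : Matrix V V ℚ :=
  Matrix.of Γ.colour

variable [Fintype V] [DecidableEq V]

/-- The adjacency polynomial: the characteristic polynomial of the adjacency matrix. -/
noncomputable def adjPoly (Γ : ColourGraph V) : Polynomial ℚ :=
  Γ.adjMatrix.charpoly

/-- The splitting field `𝕊𝔽(Γ)`: the smallest subfield of `ℂ` which contains all the eigenvalues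
of `Γ`, that is, all the complex roots of the adjacency polynomial. -/
noncomputable def splittingField (Γ : ColourGraph V) : IntermediateField ℚ ℂ :=
  IntermediateField.adjoin ℚ (Γ.adjPoly.rootSet ℂ)

/-- The algebraic degree `Deg(Γ)`: the degree of the splitting field over `ℚ`. -/
noncomputable def algDegree (Γ : ColourGraph V) : ℕ :=
  Module.finrank ℚ Γ.splittingField

end ColourGraph

/-- `f` is a class function: it is constant on conjugacy classes. -/
def IsClassFunction {G : Type*} [Group G] (f : G → ℚ) : Prop :=
  ∀ g h : G, f (g * h * g⁻¹) = f h

/-- The Cayley colour graph `Cay(G, f)`: the edge `{g, h}` has colour `f (g h⁻¹)`. -/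
def cayley {G : Type*} [Group G] (f : G → ℚ) (hf : ∀ g, f g = f g⁻¹) : ColourGraph G where
  colour g h := f (g * h⁻¹)
  symm g h := by rw [hf (g * h⁻¹), mul_inv_rev, inv_inv]

/-- The function `f ^ k`, defined by `f ^ k (g) = f (g ^ k)`. -/
def powArg {G : Type*} [Group G] (f : G → ℚ) (k : ℤ) : G → ℚ :=
  fun g => f (g ^ k)

theorem pow_val_mul {G : Type*} [Group G] [Fintype G] {n : ℕ} (hn : Fintype.card G = n)
    (a b : ZMod n) (g : G) : g ^ (a * b).val = (g ^ a.val) ^ b.val := by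
  subst hn
  rw [ZMod.val_mul, ← pow_mul, pow_mod_card]

theorem pow_val_one {G : Type*} [Group G] [Fintype G] {n : ℕ} (hn : Fintype.card G = n)
    (g : G) : g ^ (1 : ZMod n).val = g := by
  subst hn
  rw [ZMod.val_one_eq_one_mod, pow_mod_card, pow_one]

/-- The subgroup `H_f = {h ∈ (ℤ/n)ˣ | f ^ h = f}`, where `n` is the order of `G`. The residue class
`h` is represented by its least non-negative element (`g ^ h` does not depend on the choice, as
`g ^ n = 1`). -/
def fixingUnits {G : Type*} [Group G] [Fintype G] {n : ℕ} (hn : Fintype.card G = n)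
    (f : G → ℚ) : Subgroup (ZMod n)ˣ where
  carrier := {h | powArg f ((h : ZMod n).val : ℤ) = f}
  one_mem' := by
    funext g
    simp only [powArg, zpow_natCast, Units.val_one, pow_val_one hn]
  mul_mem' := by
    intro a b ha hb
    funext g
    have h1 := congrFun ha g
    have h2 := congrFun hb (g ^ (a : ZMod n).val)
    simp only [powArg, zpow_natCast] at h1 h2 ⊢
    rw [Units.val_mul, pow_val_mul hn, h2, h1]
  inv_mem' := by
    intro a ha
    funext g
    have h1 := congrFun ha (g ^ ((a⁻¹ : (ZMod n)ˣ) : ZMod n).val)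
    simp only [powArg, zpow_natCast] at h1 ⊢
    rw [← h1, ← pow_val_mul hn, Units.inv_mul, pow_val_one hn]

/-- `ζ_n = e^{2πi/n}`. -/
noncomputable def zetaC (n : ℕ) : ℂ :=
  Complex.exp (2 * Real.pi * Complex.I / n)

/-- The cyclotomic field `ℚ(ζ_n)`, as a subfield of `ℂ`. -/
noncomputable def cycField (n : ℕ) : IntermediateField ℚ ℂ :=
  ℚ⟮zetaC n⟯

theorem zetaC_isPrimitiveRoot (n : ℕ) [NeZero n] : IsPrimitiveRoot (zetaC n) n :=
  Complex.isPrimitiveRoot_exp n (NeZero.ne n)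

instance cycField_isCyclotomicExtension (n : ℕ) [NeZero n] :
    IsCyclotomicExtension {n} ℚ (cycField n) := by
  have hζ := zetaC_isPrimitiveRoot n
  have halg : IsAlgebraic ℚ (zetaC n) := (hζ.isIntegral (NeZero.pos n)).tower_top.isAlgebraic
  change IsCyclotomicExtension {n} ℚ (ℚ⟮zetaC n⟯).toSubalgebra
  rw [IntermediateField.adjoin_simple_toSubalgebra_of_isAlgebraic halg]
  exact hζ.adjoin_isCyclotomicExtension ℚ

instance cycField_numberField (n : ℕ) [NeZero n] : NumberField (cycField n) :=
  IsCyclotomicExtension.numberField {n} ℚ (cycField n)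

/-- The isomorphism `η : Gal(ℚ(ζ_n)/ℚ) ≃ (ℤ/n)ˣ` with `σ(ζ_n) = ζ_n ^ η(σ)`. -/
noncomputable def eta (n : ℕ) [NeZero n] : Gal(cycField n/ℚ) ≃* (ZMod n)ˣ :=
  IsCyclotomicExtension.Rat.galEquivZMod n (cycField n)

/-- The property which determines `η`. -/
theorem eta_spec (n : ℕ) [NeZero n] (σ : Gal(cycField n/ℚ)) :
    σ (⟨zetaC n, IntermediateField.mem_adjoin_simple_self ℚ (zetaC n)⟩ : cycField n) =
      (⟨zetaC n, IntermediateField.mem_adjoin_simple_self ℚ (zetaC n)⟩ : cycField n) ^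
        ((eta n σ : (ZMod n)ˣ) : ZMod n).val :=
  IsCyclotomicExtension.Rat.galEquivZMod_apply_of_pow_eq n (cycField n) σ
    (Subtype.ext (zetaC_isPrimitiveRoot n).pow_eq_one)

end CayleyColour

/-! The adjacency matrix is the matrix of `convolution f`, the action of `∑ f(g) g` on the regular
representation. As `f` is a class function, this operator commutes with `G`, so its eigenspaces are
subrepresentations. If it acts on a nonzero subrepresentation `N` as a scalar `a`, traces give `a ·
dim N = ∑ f(g) tr(g|N)`. Each `tr(g|N)` is a sum of `n`-th roots of unity, so `σ` sends it to
`tr(g^η(σ)|N)`. Reindexing the sum shows that `σ(a)` is the scalar by which `∑ f(g^k) g` acts on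
`N`, where `k = η(σ)⁻¹`, provided it acts as a scalar (`exists_cycField_of_convolution`).

If `η(σ) ∈ H_f`, both operators coincide and `σ` fixes every eigenvalue. Conversely, if `f^k ≠ f`,
the nonzero symmetric class function `D = f - f^k` has a nonzero eigenvalue `d`. On a joint
eigenspace of `f` and `D`, with eigenvalues `a` and `d`, this gives `σ(a) = a - d ≠ a`. The Galois
correspondence then identifies the field. -/

namespace CayleyColour

/-! ### Galois action on traces and on scalars of group algebra elements -/

section Trace

variable {M : Type*} [AddCommGroup M] [Module ℂ M] [FiniteDimensional ℂ M]

/-- The traces of the powers of an endomorphism of finite order are power sums of roots of unity. -/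
theorem exists_trace_pow_eq_sum {n : ℕ} (hn : n ≠ 0) (T : Module.End ℂ M) (hT : T ^ n = 1) :
    ∃ (S : Finset ℂ) (m : ℂ → ℕ), (∀ z ∈ S, z ^ n = 1) ∧
      ∀ k : ℕ, LinearMap.trace ℂ M (T ^ k) = ∑ z ∈ S, (m z : ℂ) * z ^ k := by
  have hss : T.IsSemisimple := by
    refine Module.End.isSemisimple_of_squarefree_aeval_eq_zero
      (p := (Polynomial.X ^ n - 1 : Polynomial ℂ)) ?_ (by simp [hT])
    exact (Polynomial.separable_X_pow_sub_C (1 : ℂ) (by exact_mod_cast hn)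
      one_ne_zero).squarefree
  have htop : ⨆ z, T.eigenspace z = ⊤ := by
    rw [← Module.End.iSup_maxGenEigenspace_eq_top T]
    exact iSup_congr fun z => (hss.isFinitelySemisimple.maxGenEigenspace_eq_eigenspace z).symm
  have hint : DirectSum.IsInternal T.eigenspace :=
    DirectSum.isInternal_submodule_of_iSupIndep_of_iSup_eq_top T.eigenspaces_iSupIndep htop
  have hfin : {z | T.eigenspace z ≠ ⊥}.Finite :=
    WellFoundedGT.finite_ne_bot_of_iSupIndep T.eigenspaces_iSupIndep
  refine ⟨hfin.toFinset, fun z => Module.finrank ℂ (T.eigenspace z), ?_, ?_⟩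
  · intro z hz
    obtain ⟨v, hv, hv0⟩ := Submodule.exists_mem_ne_zero_of_ne_bot (by simpa using hz)
    have h := Module.End.HasEigenvector.pow_apply ⟨hv, hv0⟩ n
    rw [hT] at h
    have h2 : (z ^ n - 1) • v = 0 := by rw [sub_smul, ← h]; simp
    exact sub_eq_zero.1 ((smul_eq_zero.1 h2).resolve_right hv0)
  · intro k
    have hpow : ∀ (z : ℂ) (v : M), v ∈ T.eigenspace z → (T ^ k) v = z ^ k • v := by
      intro z v hv
      by_cases hv0 : v = 0
      · simp [hv0]
      · exact Module.End.HasEigenvector.pow_apply ⟨hv, hv0⟩ k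
    have hmaps : ∀ z, Set.MapsTo (T ^ k) (T.eigenspace z) (T.eigenspace z) := by
      intro z v hv
      rw [hpow z v hv]
      exact Submodule.smul_mem _ _ hv
    rw [LinearMap.trace_eq_sum_trace_restrict' hint hfin hmaps]
    refine Finset.sum_congr rfl fun z _ => ?_
    have : (T ^ k).restrict (hmaps z) = z ^ k • LinearMap.id := by
      ext v
      exact hpow z v v.2
    rw [this, map_smul, LinearMap.trace_id, smul_eq_mul, mul_comm]

theorem mem_cycField_of_pow_eq_one {n : ℕ} [NeZero n] {z : ℂ} (hz : z ^ n = 1) :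
    z ∈ cycField n := by
  obtain ⟨i, -, rfl⟩ := (zetaC_isPrimitiveRoot n).eq_pow_of_pow_eq_one hz
  exact pow_mem (IntermediateField.mem_adjoin_simple_self ℚ _) _

/-- The Galois action on the trace of an endomorphism of order dividing `n`. -/
theorem exists_cycField_trace {n : ℕ} [NeZero n] (T : Module.End ℂ M) (hT : T ^ n = 1) :
    ∃ x : cycField n, (x : ℂ) = LinearMap.trace ℂ M T ∧
      ∀ σ : Gal(cycField n/ℚ),
        (σ x : ℂ) = LinearMap.trace ℂ M (T ^ (eta n σ : ZMod n).val) := by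
  obtain ⟨S, m, hS, htr⟩ := exists_trace_pow_eq_sum (NeZero.ne n) T hT
  let y : S → cycField n := fun z => ⟨z, mem_cycField_of_pow_eq_one (hS z z.2)⟩
  have hy : ∀ z : S, y z ^ n = 1 := fun z => Subtype.ext (hS z z.2)
  refine ⟨∑ z : S, (m z : cycField n) * y z, ?_, fun σ => ?_⟩
  · rw [← pow_one T, htr, ← S.sum_coe_sort fun z => (m z : ℂ) * z ^ 1]
    simp [y]
  · have hσ : ∀ z : S, σ (y z) = y z ^ (eta n σ : ZMod n).val := fun z =>
      IsCyclotomicExtension.Rat.galEquivZMod_apply_of_pow_eq n (cycField n) σ (hy z)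
    rw [htr, ← S.sum_coe_sort fun z => (m z : ℂ) * z ^ (eta n σ : ZMod n).val, map_sum]
    simp [hσ, y]

variable {G : Type*} [Group G] [Fintype G]

/-- If `∑ f(g) g` and `∑ f(g ^ k) g` act on a representation as scalars, where `k` is inverse to
`η(σ)`, then the first scalar lies in `ℚ(ζ_n)` and `σ` maps it to the second one. -/
theorem exists_cycField_scalar [Nontrivial M] {n : ℕ} [NeZero n] (hn : Fintype.card G = n)
    (ρ : Representation ℂ G M) (f : G → ℚ) (σ : Gal(cycField n/ℚ)) {a b : ℂ}
    (ha : ∑ g, (f g : ℂ) • ρ g = a • (1 : Module.End ℂ M))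
    (hb : ∑ g, (f (g ^ ((eta n σ)⁻¹ : (ZMod n)ˣ).val.val) : ℂ) • ρ g =
      b • (1 : Module.End ℂ M)) :
    ∃ x : cycField n, (x : ℂ) = a ∧ (σ x : ℂ) = b := by
  have hpow : ∀ g, ρ g ^ n = 1 := fun g => by
    rw [← map_pow, ← hn, pow_card_eq_one, map_one]
  choose y hy hσ using fun g => exists_cycField_trace (ρ g) (hpow g)
  set d : ℕ := Module.finrank ℂ M with hd
  have hd0 : (d : ℂ) ≠ 0 := by exact_mod_cast Module.finrank_pos.ne'
  have ha' : a * d = ∑ g, (f g : ℂ) * LinearMap.trace ℂ M (ρ g) := by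
    have := congrArg (LinearMap.trace ℂ M) ha
    simpa [map_sum, ← hd] using this.symm
  have hb' : b * d = ∑ g, (f (g ^ ((eta n σ)⁻¹ : (ZMod n)ˣ).val.val) : ℂ) *
      LinearMap.trace ℂ M (ρ g) := by
    have := congrArg (LinearMap.trace ℂ M) hb
    simpa [map_sum, ← hd] using this.symm
  refine ⟨(∑ g, (f g : cycField n) * y g) / d, ?_, ?_⟩
  · rw [eq_comm, eq_div_of_mul_eq hd0 ha']
    simp [hy]
  · rw [eq_comm, eq_div_of_mul_eq hd0 hb']
    simp only [map_div₀, map_sum, map_mul, map_ratCast, map_natCast]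
    push_cast
    simp only [hσ]
    congr 1
    -- Reindexing along this bijection moves the exponent from the trace to `f`, where it becomes
    -- the inverse exponent.
    let e : G ≃ G :=
      { toFun := fun g => g ^ (eta n σ : ZMod n).val
        invFun := fun g => g ^ ((eta n σ)⁻¹ : (ZMod n)ˣ).val.val
        left_inv := fun g => by
          simp only [← pow_val_mul hn, Units.mul_inv, pow_val_one hn]
        right_inv := fun g => by
          simp only [← pow_val_mul hn, Units.inv_mul, pow_val_one hn] }
    rw [← e.sum_comp]
    refine Finset.sum_congr rfl fun g _ => ?_
    rw [show e g ^ ((eta n σ)⁻¹ : (ZMod n)ˣ).val.val = g from e.left_inv g]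
    simp [e]

end Trace

/-! ### Convolution operators on the regular representation -/

section Regular

variable {G : Type*} [Group G]

/-- The left regular representation on complex functions on `G`. -/
noncomputable def regularRep (G : Type*) [Group G] : Representation ℂ G (G → ℂ) where
  toFun g := LinearMap.funLeft ℂ ℂ fun x => g⁻¹ * x
  map_one' := by ext; simp
  map_mul' a b := by
    refine LinearMap.ext fun v => funext fun x => ?_
    simp [LinearMap.funLeft_apply, mul_assoc]

theorem regularRep_apply (g : G) (v : G → ℂ) (x : G) : regularRep G g v x = v (g⁻¹ * x) := rfl

variable [Fintype G]

/-- The action of `∑ a(g) g` in the regular representation. -/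
noncomputable def convolution (a : G → ℚ) : Module.End ℂ (G → ℂ) :=
  ∑ g, (a g : ℂ) • regularRep G g

theorem convolution_apply (a : G → ℚ) (v : G → ℂ) (x : G) :
    convolution a v x = ∑ y, (a (x * y⁻¹) : ℂ) * v y := by
  simp only [convolution, LinearMap.sum_apply, LinearMap.smul_apply, Finset.sum_apply,
    Pi.smul_apply, regularRep_apply, smul_eq_mul]
  refine Fintype.sum_equiv ((Equiv.inv G).trans (Equiv.mulRight x)) _ _ fun g => ?_
  simp

theorem convolution_eq_toLin' [DecidableEq G] (a : G → ℚ) :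
    convolution a = Matrix.toLin' (Matrix.of fun x y => (a (x * y⁻¹) : ℂ)) := by
  refine LinearMap.ext fun v => funext fun x => ?_
  rw [convolution_apply]
  rfl

/-- Conjugation by `h⁻¹` permutes the terms of the sum and preserves their coefficients. -/
theorem IsClassFunction.commute_regularRep {a : G → ℚ} (ha : IsClassFunction a) (h : G) :
    Commute (convolution a) (regularRep G h) := by
  rw [commute_iff_eq, convolution, Finset.sum_mul, Finset.mul_sum]
  refine Fintype.sum_equiv (MulAut.conj h⁻¹).toEquiv _ _ fun g => ?_
  have : a (h⁻¹ * g * h) = a g := by simpa using ha h⁻¹ g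
  rw [mul_assoc] at this
  simp [← map_mul, this, mul_assoc]

theorem IsClassFunction.commute_convolution {a : G → ℚ} (ha : IsClassFunction a) (b : G → ℚ) :
    Commute (convolution a) (convolution b) :=
  Commute.sum_right _ _ _ fun g _ => (ha.commute_regularRep g).smul_right _

omit [Fintype G] in
theorem IsClassFunction.comp_pow {a : G → ℚ} (ha : IsClassFunction a) (k : ℕ) :
    IsClassFunction fun g => a (g ^ k) := fun g h => by
  simp only [conj_pow, ha g (h ^ k)]

theorem convolution_sub (a b : G → ℚ) :
    convolution (fun g => a g - b g) = convolution a - convolution b := by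
  refine LinearMap.ext fun v => funext fun x => ?_
  simp [convolution_apply, sub_mul, Finset.sum_sub_distrib]

/-- A nonzero symmetric rational function acts with some nonzero eigenvalue. -/
theorem exists_hasEigenvalue_convolution_ne_zero {a : G → ℚ} (ha : ∀ g, a g = a g⁻¹)
    (h0 : a ≠ 0) : ∃ d : ℂ, d ≠ 0 ∧ (convolution a).HasEigenvalue d := by
  classical
  set A : Matrix G G ℂ := Matrix.of fun x y => (a (x * y⁻¹) : ℂ) with hA
  have hherm : A.IsHermitian := by
    ext x y
    simp [hA, ha (y * x⁻¹)]
  have hne : A ≠ 0 := by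
    intro h
    refine h0 (funext fun g => ?_)
    simpa [hA] using congrFun (congrFun h g) 1
  -- A Hermitian matrix is diagonalisable, so it vanishes if all its eigenvalues do.
  obtain ⟨i, hi⟩ := Function.ne_iff.1 (mt hherm.eigenvalues_eq_zero_iff.1 hne)
  refine ⟨(hherm.eigenvalues i : ℂ), by exact_mod_cast hi, ?_⟩
  rw [convolution_eq_toLin']
  refine Module.End.hasEigenvalue_of_hasEigenvector
    (x := (hherm.eigenvectorBasis i : G → ℂ)) ⟨?_, ?_⟩
  · rw [Module.End.mem_eigenspace_iff, Matrix.toLin'_apply, hherm.mulVec_eigenvectorBasis]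
    rfl
  · intro h
    exact hherm.eigenvectorBasis.toBasis.ne_zero i (by ext x; simpa using congrFun h x)

/-- The scalars by which `∑ f(g) g` and `∑ f(g ^ k) g` act on a nonzero left ideal, with `k`
inverse to `η(σ)`, are related by `σ`. -/
theorem exists_cycField_of_convolution {n : ℕ} [NeZero n] (hn : Fintype.card G = n)
    (f : G → ℚ) (σ : Gal(cycField n/ℚ)) {a b : ℂ} (N : Subrepresentation (regularRep G))
    (hN : N.toSubmodule ≠ ⊥) (ha : ∀ v ∈ N.toSubmodule, convolution f v = a • v)
    (hb : ∀ v ∈ N.toSubmodule,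
      convolution (fun g => f (g ^ ((eta n σ)⁻¹ : (ZMod n)ˣ).val.val)) v = b • v) :
    ∃ x : cycField n, (x : ℂ) = a ∧ (σ x : ℂ) = b := by
  have := Submodule.nontrivial_iff_ne_bot.2 hN
  have key : ∀ (u : G → ℚ) (c : ℂ), (∀ v ∈ N.toSubmodule, convolution u v = c • v) →
      ∑ g, (u g : ℂ) • N.toRepresentation g = c • (1 : Module.End ℂ N.toSubmodule) := by
    intro u c h
    refine LinearMap.ext fun v => Subtype.ext ?_
    have := h v v.2
    simp only [convolution, LinearMap.sum_apply, LinearMap.smul_apply] at this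
    simpa [Subrepresentation.toRepresentation] using this
  exact exists_cycField_scalar hn N.toRepresentation f σ (key f a ha) (key _ b hb)

variable {n : ℕ} [NeZero n]

omit [NeZero n] in
theorem mem_fixingUnits (hn : Fintype.card G = n) (f : G → ℚ) (u : (ZMod n)ˣ) :
    u ∈ fixingUnits hn f ↔ ∀ g, f (g ^ (u : ZMod n).val) = f g := by
  change powArg f ((u : ZMod n).val : ℤ) = f ↔ _
  simp only [funext_iff, powArg, zpow_natCast]

theorem exists_cycField_of_hasEigenvalue (hn : Fintype.card G = n) {f : G → ℚ}
    (hcl : IsClassFunction f) {a : ℂ} (ha : (convolution f).HasEigenvalue a)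
    {σ : Gal(cycField n/ℚ)} (hσ : eta n σ ∈ fixingUnits hn f) :
    ∃ x : cycField n, (x : ℂ) = a ∧ σ x = x := by
  have hf : (fun g => f (g ^ ((eta n σ)⁻¹ : (ZMod n)ˣ).val.val)) = f :=
    funext ((mem_fixingUnits hn f _).1 (inv_mem hσ))
  let N : Subrepresentation (regularRep G) :=
    ⟨(convolution f).eigenspace a, fun g _ hv =>
      Module.End.mapsTo_genEigenspace_of_comm (hcl.commute_regularRep g) a 1 hv⟩
  have hN : ∀ v ∈ N.toSubmodule, convolution f v = a • v :=
    fun v hv => Module.End.mem_eigenspace_iff.1 hv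
  obtain ⟨x, hx, hx'⟩ := exists_cycField_of_convolution hn f σ N ha hN (by rwa [hf])
  exact ⟨x, hx, Subtype.ext (hx'.trans hx.symm)⟩

/-- Symmetry of `f` enters here: it makes the matrix of `D` Hermitian, which rules out a nonzero
nilpotent `D`. -/
theorem eta_mem_fixingUnits (hn : Fintype.card G = n) {f : G → ℚ} (hf : ∀ g, f g = f g⁻¹)
    (hcl : IsClassFunction f) {σ : Gal(cycField n/ℚ)}
    (hσ : ∀ x : cycField n, (convolution f).HasEigenvalue (x : ℂ) → σ x = x) :
    eta n σ ∈ fixingUnits hn f := by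
  rw [← inv_mem_iff, mem_fixingUnits]
  by_contra hne
  set k := ((eta n σ)⁻¹ : (ZMod n)ˣ).val.val with hk
  have hclk : IsClassFunction fun g => f (g ^ k) := hcl.comp_pow k
  set D : G → ℚ := fun g => f g - f (g ^ k) with hD
  have hDcl : IsClassFunction D := fun g h => by
    simp only [hD]
    rw [hcl g h, show f ((g * h * g⁻¹) ^ k) = f (h ^ k) from hclk g h]
  obtain ⟨d, hd0, hd⟩ := exists_hasEigenvalue_convolution_ne_zero (a := D)
    (fun g => by simp only [hD, inv_pow, ← hf]) (fun h => hne fun g =>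
      (sub_eq_zero.1 (congrFun h g)).symm)
  have hmaps : ∀ v ∈ (convolution D).eigenspace d,
      convolution f v ∈ (convolution D).eigenspace d :=
    fun v hv => Module.End.mapsTo_genEigenspace_of_comm (hDcl.commute_convolution f) d 1 hv
  have : Nontrivial ((convolution D).eigenspace d) := Submodule.nontrivial_iff_ne_bot.2 hd
  obtain ⟨a, ha⟩ := Module.End.exists_eigenvalue ((convolution f).restrict hmaps)
  obtain ⟨v, hv⟩ := ha.exists_hasEigenvector
  have hva : (v : G → ℂ) ∈ (convolution f).eigenspace a :=
    Module.End.mem_eigenspace_iff.2 (congrArg Subtype.val hv.apply_eq_smul)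
  have hv0 : (v : G → ℂ) ≠ 0 := fun h => hv.2 (Subtype.ext h)
  -- The full joint eigenspace is `G`-stable, unlike the line through `v`, which only shows that it
  -- is nonzero.
  let N : Subrepresentation (regularRep G) :=
    ⟨(convolution f).eigenspace a ⊓ (convolution D).eigenspace d, fun g _ hv =>
      ⟨Module.End.mapsTo_genEigenspace_of_comm (hcl.commute_regularRep g) a 1 hv.1,
        Module.End.mapsTo_genEigenspace_of_comm (hDcl.commute_regularRep g) d 1 hv.2⟩⟩
  have hN : N.toSubmodule ≠ ⊥ := (Submodule.ne_bot_iff _).2 ⟨v, ⟨hva, v.2⟩, hv0⟩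
  have hNa : ∀ w ∈ N.toSubmodule, convolution f w = a • w :=
    fun w hw => Module.End.mem_eigenspace_iff.1 hw.1
  have hNb : ∀ w ∈ N.toSubmodule, convolution (fun g => f (g ^ k)) w = (a - d) • w := by
    intro w hw
    have h2 : convolution D w = d • w := Module.End.mem_eigenspace_iff.1 hw.2
    rw [hD, convolution_sub, LinearMap.sub_apply, hNa w hw] at h2
    rw [sub_smul, ← h2, sub_sub_cancel]
  obtain ⟨x, hx, hx'⟩ := exists_cycField_of_convolution hn f σ N hN hNa hNb
  have hfix := hσ x (hx ▸ Module.End.hasEigenvalue_of_hasEigenvector ⟨hva, hv0⟩)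
  rw [hfix, hx] at hx'
  exact hd0 (by linear_combination hx')

variable [DecidableEq G]

theorem mem_rootSet_adjPoly_cayley (f : G → ℚ) (hf : ∀ g, f g = f g⁻¹) (z : ℂ) :
    z ∈ (cayley f hf).adjPoly.rootSet ℂ ↔ (convolution f).HasEigenvalue z := by
  have hmat : (cayley f hf).adjMatrix.map (algebraMap ℚ ℂ) =
      Matrix.of fun x y => (f (x * y⁻¹) : ℂ) := rfl
  rw [ColourGraph.adjPoly, Polynomial.mem_rootSet_of_ne (Matrix.charpoly_monic _).ne_zero, convolution_eq_toLin',
    ← hmat, Module.End.hasEigenvalue_iff_isRoot_charpoly, Matrix.charpoly_toLin',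
    Matrix.charpoly_map, Polynomial.IsRoot.def, Polynomial.eval_map_algebraMap]

end Regular

/-! ### Galois correspondence and degree -/

/-- The splitting field is the lift of the fixed field of `η⁻¹(H_f)`. -/
theorem splittingField_cayley {G : Type*} [Group G] [Fintype G] [DecidableEq G] {n : ℕ}
    [NeZero n] (hn : Fintype.card G = n) (f : G → ℚ) (hf : ∀ g, f g = f g⁻¹)
    (hcl : IsClassFunction f) :
    (cayley f hf).splittingField = IntermediateField.lift (IntermediateField.fixedField
      ((fixingUnits hn f).comap (eta n).toMonoidHom)) := by
  have hle : (cayley f hf).splittingField ≤ IntermediateField.lift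
      (IntermediateField.fixedField ((fixingUnits hn f).comap (eta n).toMonoidHom)) := by
    refine IntermediateField.adjoin_le_iff.2 fun z hz => ?_
    rw [mem_rootSet_adjPoly_cayley] at hz
    -- The identity automorphism is used only to place the eigenvalue in `ℚ(ζ_n)`.
    obtain ⟨x, rfl, -⟩ := exists_cycField_of_hasEigenvalue (n := n) hn hcl hz (σ := 1)
      (by rw [map_one]; exact one_mem _)
    refine (IntermediateField.mem_lift x).2 ((IntermediateField.mem_fixedField_iff _ _).2 ?_)
    intro σ hσ
    obtain ⟨y, hy, hy'⟩ := exists_cycField_of_hasEigenvalue hn hcl hz (σ := σ) hσ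
    rwa [Subtype.ext hy] at hy'
  have hcyc := hle.trans (IntermediateField.lift_le _)
  refine le_antisymm hle ?_
  have hres : IntermediateField.fixedField
      (IntermediateField.restrict hcyc).fixingSubgroup = IntermediateField.restrict hcyc :=
    @IsGalois.fixedField_fixingSubgroup ℚ _ (cycField n) _ (IntermediateField.algebra' _) _
      (NumberField.to_finiteDimensional (K := cycField n))
      (IsCyclotomicExtension.isGalois {n} ℚ (cycField n))
  -- Passing to fixed fields reverses this inclusion, which gives the remaining containment.
  have hsub : (IntermediateField.restrict hcyc).fixingSubgroup ≤
      (fixingUnits hn f).comap (eta n).toMonoidHom := by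
    intro σ hσ
    rw [IntermediateField.mem_fixingSubgroup_iff] at hσ
    refine eta_mem_fixingUnits hn hf hcl fun x hx => hσ x ?_
    exact (IntermediateField.mem_restrict hcyc x).2 (IntermediateField.subset_adjoin _ _
      ((mem_rootSet_adjPoly_cayley f hf _).2 hx))
  exact (IntermediateField.map_mono _ (IntermediateField.fixedField_antitone hsub)).trans_eq
    ((congrArg IntermediateField.lift hres).trans (IntermediateField.lift_restrict hcyc))

theorem finrank_lift_fixedField_mul_card (n : ℕ) [NeZero n] (H : Subgroup (ZMod n)ˣ) :
    Module.finrank ℚ (IntermediateField.lift (IntermediateField.fixedField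
      (H.comap (eta n).toMonoidHom))) * Nat.card H = n.totient := by
  have hcard : Nat.card (H.comap (eta n).toMonoidHom) = Nat.card H :=
    Nat.card_congr ((eta n).toEquiv.subtypeEquiv fun _ => Iff.rfl)
  rw [← (IntermediateField.liftAlgEquiv (IntermediateField.fixedField
      (H.comap (eta n).toMonoidHom))).toLinearEquiv.finrank_eq, ← hcard,
    ← IntermediateField.finrank_fixedField_eq_card]
  exact (Module.finrank_mul_finrank ℚ (IntermediateField.fixedField
    (H.comap (eta n).toMonoidHom)) (cycField n)).trans
      (IsCyclotomicExtension.finrank (cycField n)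
        (Polynomial.cyclotomic.irreducible_rat (NeZero.pos n)))

end CayleyColour

theorem mainTheorem1 {G : Type*} [Group G] [Fintype G] [DecidableEq G] (n : ℕ) [NeZero n]
    (hn : Fintype.card G = n) (f : G → ℚ) (hf : ∀ g, f g = f g⁻¹)
    (hcl : CayleyColour.IsClassFunction f) :
    (CayleyColour.cayley f hf).splittingField =
        IntermediateField.lift (IntermediateField.fixedField
          ((CayleyColour.fixingUnits hn f).comap (CayleyColour.eta n).toMonoidHom)) ∧
      ((CayleyColour.cayley f hf).splittingField : Set ℂ) =
        {x : ℂ | ∃ hx : x ∈ CayleyColour.cycField n,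
          ∀ σ : Gal(CayleyColour.cycField n/ℚ),
            CayleyColour.eta n σ ∈ CayleyColour.fixingUnits hn f →
              σ ⟨x, hx⟩ = ⟨x, hx⟩} ∧
      ((CayleyColour.cayley f hf).algDegree : ℚ) =
        (Nat.totient n : ℚ) / (Nat.card (CayleyColour.fixingUnits hn f) : ℚ) := by
  have hsf := CayleyColour.splittingField_cayley hn f hf hcl
  refine ⟨hsf, ?_, ?_⟩
  · ext x
    rw [hsf, SetLike.mem_coe, Set.mem_ofPred_eq]
    constructor
    · intro h
      have hx := IntermediateField.lift_le _ h
      exact ⟨hx, fun σ hσ => (IntermediateField.mem_fixedField_iff _ _).1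
        ((IntermediateField.mem_lift ⟨x, hx⟩).1 h) σ hσ⟩
    · rintro ⟨hx, h⟩
      exact (IntermediateField.mem_lift ⟨x, hx⟩).2
        ((IntermediateField.mem_fixedField_iff _ _).2 fun σ hσ => h σ hσ)
  · rw [eq_div_iff (by exact_mod_cast Nat.card_pos.ne'), CayleyColour.ColourGraph.algDegree, hsf]
    exact_mod_cast CayleyColour.finrank_lift_fixedField_mul_card n _
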